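/- Let $P_n$ be the path with vertex set $\{1,\dots,n\}$ and edges $\{j,j+1\}$ for $1\le j\le n-1$. Its 2-fold blow-up $\overset{2}{\uplus}P_n$ is the graph with vertex set $\mathbb{Z}_2\times\{1,\dots,n\}$ in which $(l,u)$ and $(m,v)$ are adjacent if and only if $u$ and $v$ are adjacent in $P_n$. A finite simple graph with adjacency matrix $A$ and transition matrix $U(t)=\exp(itA)$, $t\in\mathbb{R}$, exhibits pretty good state transfer (PGST) between vertices $a$ and $b$ if there is a sequence of real numbers $\tau_k$ with $\lim_{k\to\infty}|U(\tau_k)_{a,b}|=1$. Suppose that $n=p-1$ for some odd prime $p$, or $n=2p-1$ for some prime $p$, or $n=2^t-1$ for some integer $t\ge 1$, and let $u\in\{1,\dots,n\}$. Then PGST occurs between the vertices $(0,u)$ and $(1,u)$ of $\overset{2}{\uplus}P_n$ if and only if 1. $n=p-1$ for some odd prime $p$ (and $u$ is any vertex of $P_n$), or 2. $n=2p-1$ for some prime $p$ or $n=2^t-1$ for some integer $t\ge 1$, and $u$ is even. -/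

import Mathlib

open Filter Topology

/-- The blow-up of `m` copies of `G`: the graph on `ZMod m × V` in which `(k, u)` and `(l, v)`
are adjacent if and only if `u` and `v` are adjacent in `G`. -/
def blowUp {V : Type*} (m : ℕ) (G : SimpleGraph V) : SimpleGraph (ZMod m × V) where
  Adj a b := G.Adj a.2 b.2
  symm := ⟨fun _ _ h => SimpleGraph.Adj.symm h⟩
  loopless := ⟨fun a h => G.loopless.irrefl a.2 h⟩

open Classical in
/-- The transition matrix `U(t) = exp(itA)` of the continuous-time quantum walk on `G`,
where `A` is the adjacency matrix of `G`. -/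
noncomputable def transitionMatrix {V : Type*} [Fintype V] [DecidableEq V] (G : SimpleGraph V) (t : ℝ) :
    Matrix V V ℂ :=
  NormedSpace.exp ((Complex.I * (t : ℂ)) • G.adjMatrix ℂ)

/-- Pretty good state transfer between `a` and `b` in `G`: there is a sequence of real times
along which the modulus of the `(a, b)` entry of the transition matrix tends to `1`. -/
def HasPGST {V : Type*} [Fintype V] [DecidableEq V] (G : SimpleGraph V) (a b : V) : Prop :=
  ∃ τ : ℕ → ℝ, Tendsto (fun k => ‖transitionMatrix G (τ k) a b‖) atTop (𝓝 1)

/-!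
The adjacency matrix of the double blow-up of `P_n` is `J ⊗ A`, with `J` the all-ones `2 × 2` matrix
and `A` the adjacency matrix of the path. Its eigenvectors are those of `A` repeated on both copies,
with twice the eigenvalue, and the differences of the two copies of a vertex, with eigenvalue `0`.
So the entry of `exp (itJ ⊗ A)` between the two copies of a vertex is
`(∑ j, w j * exp (2iθ_j t) - 1) / 2`, where `θ_j = 2 cos (π j / (n + 1))` are the eigenvalues of the
path and the weights `w j`, proportional to `sin² (π j u / (n + 1))`, are nonnegative with sum `1`
(`transitionMatrix_blowUp_pathGraph_apply`). Its modulus tends to `1` along a sequence of times only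
if all phases of positive weight tend to `-1`.

If `n` is odd, `0` is an eigenvalue of the path, with positive weight exactly at the vertices with
an odd label. Its phase is constantly `1`, which rules out state transfer at those vertices
(`not_hasPGST_of_pathWeight_pos`).

In all other cases the eigenvalues that matter come in pairs `±θ`, and it is enough that the
positive ones are linearly independent over `ℤ`: then Kronecker's approximation theorem
(`exists_forall_norm_exp_sub_lt`) brings all phases close to `-1` simultaneously. The independence
comes from cyclotomic polynomials. With `ζ = exp (π i / N)`, `N = n + 1`, a relation between the
`cos (π j / N)` for `1 ≤ j ≤ M`, where `M` is the integer part of `(N - 1) / 2`, is a polynomial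
relation for `ζ` of degree at most `2M` whose middle coefficient vanishes. For `N` a power of two,
`2M < φ (2N)`, so the relation is trivial. For `N = p` and `N = 2p` with `p` an odd prime,
`2M = φ (2N)`, so the relation is a multiple of the minimal polynomial
`1 - X ^ e + X ^ (2e) - ⋯ + X ^ (e (p - 1))`, `e = N / p`; the middle coefficient of the latter is
`±1`, so again the relation is trivial.
-/

/-! ### Kronecker's approximation theorem -/

/-- The function `f` has time average `c`: `(1 / T) ∫₀ᵀ f` tends to `c` as `T → ∞`. -/
def HasMean (f : ℝ → ℂ) (c : ℂ) : Prop :=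
  Tendsto (fun T : ℝ => (T : ℂ)⁻¹ * ∫ t in (0 : ℝ)..T, f t) atTop (𝓝 c)

lemma HasMean.norm_le {f : ℝ → ℂ} {c : ℂ} (h : HasMean f c) {B : ℝ} (hB : ∀ t, ‖f t‖ ≤ B) :
    ‖c‖ ≤ B := by
  refine le_of_tendsto h.norm ?_
  filter_upwards [eventually_gt_atTop 0] with T hT
  have h1 : ‖∫ t in (0 : ℝ)..T, f t‖ ≤ B * |T - 0| :=
    intervalIntegral.norm_integral_le_of_norm_le_const fun t _ => hB t
  rw [sub_zero, abs_of_pos hT] at h1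
  rw [norm_mul, norm_inv, Complex.norm_real, Real.norm_of_nonneg hT.le, inv_mul_le_iff₀ hT]
  linarith

lemma hasMean_exp (ω : ℝ) :
    HasMean (fun t => Complex.exp (Complex.I * (ω * t))) (if ω = 0 then 1 else 0) := by
  unfold HasMean
  split_ifs with hω
  · subst hω
    refine tendsto_const_nhds.congr' ?_
    filter_upwards [eventually_gt_atTop 0] with T hT
    have : (T : ℂ) ≠ 0 := by exact_mod_cast hT.ne'
    simp [this]
  · have hc : Complex.I * (ω : ℂ) ≠ 0 := by simp [hω]
    rw [tendsto_zero_iff_norm_tendsto_zero]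
    have h2 : Tendsto (fun T : ℝ => T⁻¹ * (2 / |ω|)) atTop (𝓝 0) := by
      simpa using tendsto_inv_atTop_zero.mul_const (2 / |ω|)
    refine squeeze_zero' (Eventually.of_forall fun _ => norm_nonneg _) ?_ h2
    filter_upwards [eventually_gt_atTop 0] with T hT
    simp_rw [← mul_assoc]
    rw [integral_exp_mul_complex hc, norm_mul, norm_inv, Complex.norm_real,
      Real.norm_of_nonneg hT.le, norm_div, norm_mul, Complex.norm_I, one_mul, Complex.norm_real,
      Real.norm_eq_abs]
    gcongr
    refine (norm_sub_le _ _).trans ?_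
    have : Complex.I * (ω : ℂ) * (T : ℂ) = ((ω * T : ℝ) : ℂ) * Complex.I := by
      push_cast; ring
    rw [this, Complex.norm_exp_ofReal_mul_I]
    simp
    norm_num

lemma HasMean.sum {α : Type*} {s : Finset α} {f : α → ℝ → ℂ} {m : α → ℂ}
    (hf : ∀ a ∈ s, Continuous (f a)) (h : ∀ a ∈ s, HasMean (f a) (m a)) (c : α → ℂ) :
    HasMean (fun t => ∑ a ∈ s, c a * f a t) (∑ a ∈ s, c a * m a) := by
  unfold HasMean
  have key : Tendsto (fun T : ℝ => ∑ a ∈ s, c a * ((T : ℂ)⁻¹ * ∫ t in (0 : ℝ)..T, f a t)) atTop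
      (𝓝 (∑ a ∈ s, c a * m a)) :=
    tendsto_finsetSum _ fun a ha => (h a ha).const_mul (c a)
  refine key.congr fun T => ?_
  rw [intervalIntegral.integral_finsetSum
    fun a ha => ((hf a ha).const_mul (c a)).intervalIntegrable _ _, Finset.mul_sum]
  refine Finset.sum_congr rfl fun a _ => ?_
  rw [intervalIntegral.integral_const_mul]
  ring

/-- Independent frequencies behave like independent random variables: the time average of a
product of trigonometric polynomials, one in each `exp (i θ j t)`, is the product of their constant
terms. -/
lemma hasMean_prod {ι α : Type*} [Fintype ι] {θ : ι → ℝ} (hθ : LinearIndependent ℤ θ)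
    (s : Finset α) (d : α → ℤ) (c : ι → α → ℂ) :
    HasMean (fun t => ∏ j, ∑ x ∈ s, c j x * Complex.exp (Complex.I * (d x * θ j * t)))
      (∏ j, ∑ x ∈ s, if d x = 0 then c j x else 0) := by
  classical
  have h1 : ∀ t : ℝ, ∏ j, ∑ x ∈ s, c j x * Complex.exp (Complex.I * (d x * θ j * t)) =
      ∑ a ∈ Fintype.piFinset fun _ : ι => s, (∏ j, c j (a j)) *
        Complex.exp (Complex.I * ((∑ j, (d (a j) : ℝ) * θ j : ℝ) * t)) := by
    intro t
    rw [Finset.prod_univ_sum]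
    refine Finset.sum_congr rfl fun a _ => ?_
    rw [Finset.prod_mul_distrib, ← Complex.exp_sum]
    push_cast
    rw [Finset.sum_mul, Finset.mul_sum]
  have h2 : ∏ j, ∑ x ∈ s, (if d x = 0 then c j x else 0) =
      ∑ a ∈ Fintype.piFinset fun _ : ι => s, (∏ j, c j (a j)) *
        (if ∑ j, (d (a j) : ℝ) * θ j = 0 then 1 else 0) := by
    rw [Finset.prod_univ_sum]
    refine Finset.sum_congr rfl fun a _ => ?_
    by_cases h : ∀ j, d (a j) = 0
    · simp [h]
    · have h' : ¬ ∑ j, (d (a j) : ℝ) * θ j = 0 := fun h0 =>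
        h (Fintype.linearIndependent_iff.1 hθ (fun j => d (a j)) (by simpa using h0))
      obtain ⟨j, hj⟩ := not_forall.1 h
      rw [if_neg h', mul_zero]
      exact Finset.prod_eq_zero (Finset.mem_univ j) (if_neg hj)
  rw [h2]
  simp_rw [h1]
  exact HasMean.sum (fun a _ => by fun_prop) (fun a _ => hasMean_exp _) _

lemma norm_one_add_div_two_sq {z : ℂ} (hz : ‖z‖ = 1) :
    ‖(1 + z) / 2‖ ^ 2 = 1 - ‖z - 1‖ ^ 2 / 4 := by
  have h := parallelogram_law_with_norm ℝ z 1
  rw [hz, norm_one] at h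
  rw [norm_div, add_comm 1 z, div_pow]
  norm_num
  nlinarith

/-- **Kronecker's approximation theorem**: if the frequencies `θ j` are linearly independent over
`ℤ`, then the flow `t ↦ (exp (i θ j t))ⱼ` comes arbitrarily close to any point of the torus.
The proof is Bohr's. If `zⱼ = exp (i θ j t) / w j` stayed away from `(1, …, 1)`, the product of
the `|(1 + zⱼ) / 2|` would be bounded by some `q < 1`. The product over `j` of
`((1 + zⱼ) / 2) ^ K * ∑ l ≤ K, zⱼ ^ (-l)` has time average `1`, but its modulus is at most
`q ^ K * (K + 1) ^ card ι`, which tends to `0`. -/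
theorem exists_forall_norm_exp_sub_lt {ι : Type*} [Fintype ι] {θ : ι → ℝ}
    (hθ : LinearIndependent ℤ θ) {w : ι → ℂ} (hw : ∀ j, ‖w j‖ = 1) {ε : ℝ} (hε : 0 < ε) :
    ∃ t : ℝ, ∀ j, ‖Complex.exp (Complex.I * (θ j * t)) - w j‖ < ε := by
  by_contra! hfar
  have hw' : ∀ j, w j * (starRingEnd ℂ) (w j) = 1 := fun j => by
    rw [Complex.mul_conj']; simp [hw j]
  have he : ∀ x : ℝ, ‖Complex.exp (Complex.I * x)‖ = 1 := fun x => by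
    rw [mul_comm]; exact Complex.norm_exp_ofReal_mul_I x
  set z : ι → ℝ → ℂ := fun j t => (starRingEnd ℂ) (w j) * Complex.exp (Complex.I * (θ j * t))
    with hz
  have hz1 : ∀ j t, ‖z j t‖ = 1 := fun j t => by
    have := he (θ j * t)
    push_cast at this
    simp [hz, hw j, this]
  have hzd : ∀ j t, ‖z j t - 1‖ = ‖Complex.exp (Complex.I * (θ j * t)) - w j‖ := fun j t => by
    have : z j t - 1 = (starRingEnd ℂ) (w j) * (Complex.exp (Complex.I * (θ j * t)) - w j) := by
      rw [mul_sub, mul_comm _ (w j), hw' j]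
    rw [this, norm_mul, RCLike.norm_conj, hw j, one_mul]
  set q : ℝ := Real.sqrt (1 - ε ^ 2 / 4) with hq
  have hq1 : q < 1 := by
    rw [hq, Real.sqrt_lt' one_pos]
    have : 0 < ε ^ 2 := by positivity
    linarith
  have hle1 : ∀ j t, ‖(1 + z j t) / 2‖ ≤ 1 := fun j t => by
    have := norm_one_add_div_two_sq (hz1 j t)
    nlinarith [sq_nonneg ‖z j t - 1‖, norm_nonneg ((1 + z j t) / 2)]
  have hprod : ∀ t, ∏ j, ‖(1 + z j t) / 2‖ ≤ q := fun t => by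
    classical
    obtain ⟨j, hj⟩ := hfar t
    rw [← Finset.mul_prod_erase _ _ (Finset.mem_univ j)]
    have h1 : ‖(1 + z j t) / 2‖ ≤ q := by
      refine Real.le_sqrt_of_sq_le ?_
      rw [norm_one_add_div_two_sq (hz1 j t), hzd]
      gcongr
    refine (mul_le_of_le_one_right (norm_nonneg _) ?_).trans h1
    exact Finset.prod_le_one (fun _ _ => norm_nonneg _) fun i _ => hle1 i t
  have hbound : ∀ K : ℕ, (1 : ℝ) ≤ q ^ K * ((K : ℝ) + 1) ^ Fintype.card ι := fun K => by
    have hm := hasMean_prod hθ (Finset.range (K + 1) ×ˢ Finset.range (K + 1))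
      (fun x => (x.1 : ℤ) - x.2)
      (fun j x => ((K.choose x.1 : ℂ) / 2 ^ K * (starRingEnd ℂ) (w j) ^ x.1) * w j ^ x.2)
    have hone : ∀ j, ∑ x ∈ Finset.range (K + 1) ×ˢ Finset.range (K + 1),
        (if (x.1 : ℤ) - x.2 = 0 then
          ((K.choose x.1 : ℂ) / 2 ^ K * (starRingEnd ℂ) (w j) ^ x.1) * w j ^ x.2 else 0) = 1 := by
      intro j
      rw [Finset.sum_product]
      have : ∀ k ∈ Finset.range (K + 1), ∑ l ∈ Finset.range (K + 1),
          (if (k : ℤ) - l = 0 then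
            ((K.choose k : ℂ) / 2 ^ K * (starRingEnd ℂ) (w j) ^ k) * w j ^ l else 0) =
          (K.choose k : ℂ) / 2 ^ K := by
        intro k hk
        simp_rw [sub_eq_zero, Nat.cast_inj]
        rw [Finset.sum_ite_eq, if_pos hk, mul_assoc, ← mul_pow, mul_comm _ (w j), hw' j]
        simp
      rw [Finset.sum_congr rfl this, ← Finset.sum_div, div_eq_one_iff_eq (by simp)]
      exact_mod_cast Nat.sum_range_choose K
    rw [Finset.prod_congr rfl fun j _ => hone j, Finset.prod_const_one] at hm
    rw [← norm_one (α := ℂ)]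
    refine hm.norm_le fun t => ?_
    have hfac : ∀ j, ∑ x ∈ Finset.range (K + 1) ×ˢ Finset.range (K + 1),
        ((K.choose x.1 : ℂ) / 2 ^ K * (starRingEnd ℂ) (w j) ^ x.1) * w j ^ x.2 *
          Complex.exp (Complex.I * (((x.1 : ℤ) - x.2 : ℤ) * θ j * t)) =
        ((1 + z j t) / 2) ^ K *
          ∑ l ∈ Finset.range (K + 1), (w j * Complex.exp (-(Complex.I * (θ j * t)))) ^ l := by
      intro j
      rw [div_pow, add_comm 1, add_pow, Finset.sum_div, Finset.sum_mul_sum, Finset.sum_product]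
      refine Finset.sum_congr rfl fun k _ => Finset.sum_congr rfl fun l _ => ?_
      have : Complex.exp (Complex.I * (((k : ℤ) - l : ℤ) * θ j * t)) =
          Complex.exp (Complex.I * (θ j * t)) ^ k *
            Complex.exp (-(Complex.I * (θ j * t))) ^ l := by
        rw [← Complex.exp_nat_mul, ← Complex.exp_nat_mul, ← Complex.exp_add]
        congr 1
        push_cast
        ring
      rw [this]
      simp only [hz, mul_pow, one_pow]
      ring
    rw [Finset.prod_congr rfl fun j _ => hfac j, norm_prod]
    simp_rw [norm_mul, norm_pow]
    rw [Finset.prod_mul_distrib, Finset.prod_pow]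
    refine mul_le_mul (pow_le_pow_left₀ (Finset.prod_nonneg fun _ _ => norm_nonneg _)
      (hprod t) K) ?_ (Finset.prod_nonneg fun _ _ => norm_nonneg _)
      (pow_nonneg (Real.sqrt_nonneg _) _)
    rw [← Finset.card_univ, ← Finset.prod_const]
    refine Finset.prod_le_prod (fun _ _ => norm_nonneg _) fun j _ => ?_
    refine (norm_sum_le _ _).trans ?_
    refine (Finset.sum_le_card_nsmul _ _ 1 fun l _ => ?_).trans (by simp)
    have h1 := he (-(θ j * t))
    push_cast at h1
    rw [mul_neg] at h1
    rw [norm_pow, norm_mul, hw j, h1]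
    simp
  have hlim : Tendsto (fun K : ℕ => q ^ K * ((K : ℝ) + 1) ^ Fintype.card ι) atTop (𝓝 0) := by
    rcases (Real.sqrt_nonneg (1 - ε ^ 2 / 4)).eq_or_lt with h0 | h0
    · refine tendsto_const_nhds.congr' ?_
      filter_upwards [eventually_gt_atTop 0] with K hK
      rw [hq, ← h0, zero_pow hK.ne', zero_mul]
    · have h := (tendsto_pow_const_mul_const_pow_of_lt_one (Fintype.card ι)
        (Real.sqrt_nonneg _) hq1).comp (tendsto_add_atTop_nat 1)
      have h' := h.const_mul q⁻¹
      rw [mul_zero] at h'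
      refine h'.congr fun K => ?_
      have : q ≠ 0 := h0.ne'
      simp only [Function.comp, ← hq]
      push_cast
      field_simp
      ring
  exact absurd (ge_of_tendsto' hlim hbound) (by norm_num)

/-! ### Linear independence of cosines at rational multiples of `π` -/

/-- For `ζ = exp (π i / N)`, a relation `∑ aⱼ cos (π j / N) = 0` becomes, after multiplication by
`2 ζ ^ M`, a polynomial relation for `ζ`. -/
lemma aeval_cos_polynomial {N M : ℕ} (a : Fin M → ℤ)
    (h : ∑ j, a j • Real.cos (Real.pi * ((j : ℕ) + 1) / N) = 0) :
    Polynomial.aeval (Complex.exp (Real.pi * Complex.I / N))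
      (∑ j : Fin M, Polynomial.C (a j) *
        (Polynomial.X ^ (M + (j + 1)) + Polynomial.X ^ (M - (j + 1)) : Polynomial ℤ)) = 0 := by
  set ζ := Complex.exp (Real.pi * Complex.I / N) with hζ
  have key : ∀ j : Fin M, ζ ^ (M + ((j : ℕ) + 1)) + ζ ^ (M - ((j : ℕ) + 1)) =
      2 * ζ ^ M * (Real.cos (Real.pi * ((j : ℕ) + 1) / N) : ℝ) := by
    intro j
    have hj : M = (M - ((j : ℕ) + 1)) + ((j : ℕ) + 1) := by omega
    have h1 : ζ ^ M = ζ ^ (M - ((j : ℕ) + 1)) * ζ ^ ((j : ℕ) + 1) := by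
      rw [← pow_add, ← hj]
    have h2 : ζ ^ ((j : ℕ) + 1) =
        Complex.exp (((Real.pi * ((j : ℕ) + 1) / N : ℝ) : ℂ) * Complex.I) := by
      rw [hζ, ← Complex.exp_nat_mul]
      congr 1
      push_cast
      ring
    have h3 : ζ ^ ((j : ℕ) + 1) *
        Complex.exp (-((Real.pi * ((j : ℕ) + 1) / N : ℝ) : ℂ) * Complex.I) = 1 := by
      rw [h2, ← Complex.exp_add]
      simp
    rw [Complex.ofReal_cos, mul_assoc, mul_left_comm, Complex.two_cos, ← h2, pow_add]
    rw [mul_add, h1]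
    linear_combination (-ζ ^ (M - ((j : ℕ) + 1))) * h3
  have h4 := congrArg (fun x : ℝ => 2 * ζ ^ M * (x : ℂ)) h
  simp only [Complex.ofReal_zero, mul_zero] at h4
  rw [← h4, map_sum]
  push_cast
  rw [Finset.mul_sum]
  refine Finset.sum_congr rfl fun j _ => ?_
  have := key j
  push_cast at this
  simp only [map_mul, map_add, map_pow, Polynomial.aeval_X, Polynomial.aeval_C, zsmul_eq_mul]
  rw [this]
  simp
  ring

lemma isPrimitiveRoot_exp_pi_div {N : ℕ} (hN : 0 < N) :
    IsPrimitiveRoot (Complex.exp (Real.pi * Complex.I / N)) (2 * N) := by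
  have h := Complex.isPrimitiveRoot_exp (2 * N) (by omega)
  convert h using 2
  push_cast
  have : (N : ℂ) ≠ 0 := by exact_mod_cast hN.ne'
  field_simp

/-- No nonzero integer polynomial of degree less than `φ (2N)` vanishes at `exp (π i / N)`, since
the minimal polynomial of this number is the cyclotomic polynomial `Φ (2N)`. -/
lemma eq_zero_of_aeval_exp_eq_zero {N : ℕ} (hN : 0 < N) {Q : Polynomial ℤ}
    (hQ : Polynomial.aeval (Complex.exp (Real.pi * Complex.I / N)) Q = 0)
    (hdeg : Q.natDegree < (2 * N).totient) : Q = 0 := by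
  have hprim := isPrimitiveRoot_exp_pi_div hN
  by_contra h0
  have hdvd : Polynomial.cyclotomic (2 * N) ℤ ∣ Q := by
    rw [Polynomial.cyclotomic_eq_minpoly hprim (by omega)]
    exact minpoly.isIntegrallyClosed_dvd (hprim.isIntegral (by omega)) hQ
  have := Polynomial.natDegree_le_of_dvd hdvd h0
  rw [Polynomial.natDegree_cyclotomic] at this
  omega

section CosPolynomial

variable {M : ℕ} (a : Fin M → ℤ)

lemma coeff_cos_polynomial (m : ℕ) :
    (∑ j : Fin M, Polynomial.C (a j) *
        (Polynomial.X ^ (M + (j + 1)) + Polynomial.X ^ (M - (j + 1)) : Polynomial ℤ)).coeff m =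
      ∑ j : Fin M, ((if m = M + (j + 1) then a j else 0) +
        (if m = M - (j + 1) then a j else 0)) := by
  simp [Polynomial.coeff_X_pow, mul_add]

lemma natDegree_cos_polynomial_le :
    (∑ j : Fin M, Polynomial.C (a j) *
        (Polynomial.X ^ (M + (j + 1)) + Polynomial.X ^ (M - (j + 1)) : Polynomial ℤ)).natDegree
      ≤ 2 * M := by
  rw [Polynomial.natDegree_le_iff_coeff_eq_zero]
  intro m hm
  rw [coeff_cos_polynomial]
  refine Finset.sum_eq_zero fun j _ => ?_
  rw [if_neg (by omega), if_neg (by omega), add_zero]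

lemma coeff_cos_polynomial_mid :
    (∑ j : Fin M, Polynomial.C (a j) *
        (Polynomial.X ^ (M + (j + 1)) + Polynomial.X ^ (M - (j + 1)) : Polynomial ℤ)).coeff M
      = 0 := by
  rw [coeff_cos_polynomial]
  refine Finset.sum_eq_zero fun j _ => ?_
  rw [if_neg (by omega), if_neg (by omega), add_zero]

lemma eq_zero_of_cos_polynomial_eq_zero
    (h : ∑ j : Fin M, Polynomial.C (a j) *
        (Polynomial.X ^ (M + (j + 1)) + Polynomial.X ^ (M - (j + 1)) : Polynomial ℤ) = 0)
    (i : Fin M) : a i = 0 := by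
  have h1 := coeff_cos_polynomial a (M + (i + 1))
  rw [h, Polynomial.coeff_zero, Finset.sum_eq_single i] at h1
  · rw [if_pos rfl, if_neg (by omega), add_zero] at h1
    exact h1.symm
  · intro j _ hj
    have : (j : ℕ) ≠ i := fun h => hj (Fin.ext h)
    rw [if_neg (by omega), if_neg (by omega), add_zero]
  · simp

end CosPolynomial

lemma linearIndependent_cos_of_two_mul_lt_totient {N M : ℕ} (hN : 0 < N)
    (h : 2 * M < (2 * N).totient) :
    LinearIndependent ℤ (fun j : Fin M => Real.cos (Real.pi * ((j : ℕ) + 1) / N)) := by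
  rw [Fintype.linearIndependent_iff]
  intro a ha
  exact eq_zero_of_cos_polynomial_eq_zero a (eq_zero_of_aeval_exp_eq_zero hN
    (aeval_cos_polynomial a ha) ((natDegree_cos_polynomial_le a).trans_lt h))

/-- The borderline case `φ (2N) = 2M`. Here the polynomial attached to a relation between the
cosines is a multiple of any given monic `R` of degree `2M` that vanishes at `exp (π i / N)`, and
the multiple is trivial since only the former has vanishing middle coefficient. -/
lemma linearIndependent_cos_of_monic {N M : ℕ} (hN : 0 < N)
    (h : (2 * N).totient = 2 * M) {R : Polynomial ℤ} (hR : R.Monic) (hdeg : R.natDegree = 2 * M)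
    (hroot : Polynomial.aeval (Complex.exp (Real.pi * Complex.I / N)) R = 0)
    (hmid : R.coeff M ≠ 0) :
    LinearIndependent ℤ (fun j : Fin M => Real.cos (Real.pi * ((j : ℕ) + 1) / N)) := by
  rw [Fintype.linearIndependent_iff]
  intro a ha
  have hQ := aeval_cos_polynomial a ha
  have hd := natDegree_cos_polynomial_le a
  have hm := coeff_cos_polynomial_mid a
  refine eq_zero_of_cos_polynomial_eq_zero a ?_
  set Q := ∑ j : Fin M, Polynomial.C (a j) *
        (Polynomial.X ^ (M + (j + 1)) + Polynomial.X ^ (M - (j + 1)) : Polynomial ℤ)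
  set c := Q.coeff (2 * M) with hc
  have hsub : Q - Polynomial.C c * R = 0 := by
    by_contra hne
    refine hne (eq_zero_of_aeval_exp_eq_zero hN ?_ ?_)
    · simp [hQ, hroot]
    · rw [h]
      have hle : (Q - Polynomial.C c * R).natDegree ≤ 2 * M := by
        refine (Polynomial.natDegree_sub_le _ _).trans (max_le hd ?_)
        exact (Polynomial.natDegree_C_mul_le _ _).trans hdeg.le
      refine lt_of_le_of_ne hle fun heq => hne ?_
      rw [← Polynomial.leadingCoeff_eq_zero, Polynomial.leadingCoeff, heq, Polynomial.coeff_sub,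
        Polynomial.coeff_C_mul, ← hc]
      have : R.coeff (2 * M) = 1 := by rw [← hdeg]; exact hR
      rw [this]
      ring
  have hQR := sub_eq_zero.1 hsub
  have hcz : c = 0 := by
    rw [hQR, Polynomial.coeff_C_mul] at hm
    exact (mul_eq_zero.1 hm).resolve_right hmid
  rw [hQR, hcz]
  simp

/-- `1 - X ^ e + X ^ (2e) - ⋯ + X ^ (e (p - 1))` for odd `p`. For `p` an odd prime and `e = 1, 2`
this is the cyclotomic polynomial `Φ (2ep)`. -/
noncomputable def altGeomPolynomial (e p : ℕ) : Polynomial ℤ :=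
  ∑ i ∈ Finset.range p, Polynomial.C ((-1) ^ i) * Polynomial.X ^ (e * i)

lemma coeff_altGeomPolynomial {e p : ℕ} (he : 0 < e) (i : ℕ) :
    (altGeomPolynomial e p).coeff (e * i) = if i < p then (-1) ^ i else 0 := by
  simp only [altGeomPolynomial, Polynomial.finsetSum_coeff, Polynomial.coeff_C_mul,
    Polynomial.coeff_X_pow, Nat.mul_right_inj he.ne', mul_ite, mul_one, mul_zero]
  simp

lemma natDegree_altGeomPolynomial_le (e p : ℕ) :
    (altGeomPolynomial e p).natDegree ≤ e * (p - 1) := by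
  refine Polynomial.natDegree_sum_le_of_forall_le _ _ fun i hi => ?_
  refine (Polynomial.natDegree_C_mul_X_pow_le _ _).trans ?_
  have := Finset.mem_range.1 hi
  gcongr
  omega

lemma aeval_altGeomPolynomial {e p : ℕ} (hp : Odd p) {ζ : ℂ} (h1 : ζ ^ (e * p) = -1)
    (h2 : ζ ^ e ≠ -1) : Polynomial.aeval ζ (altGeomPolynomial e p) = 0 := by
  have h3 : Polynomial.aeval ζ (altGeomPolynomial e p) =
      ∑ i ∈ Finset.range p, (-ζ ^ e) ^ i := by
    simp only [altGeomPolynomial, map_sum, map_mul, map_pow, Polynomial.aeval_X]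
    refine Finset.sum_congr rfl fun i _ => ?_
    rw [neg_pow (ζ ^ e) i, ← pow_mul]
    simp
  have h4 := geom_sum_mul (-ζ ^ e) p
  rw [← h3, hp.neg_pow, ← pow_mul, h1, neg_neg, sub_self] at h4
  refine (mul_eq_zero.1 h4).resolve_right fun h => h2 ?_
  linear_combination -h

lemma exp_pi_div_pow (N k : ℕ) :
    Complex.exp (Real.pi * Complex.I / N) ^ k =
      Complex.exp ((k : ℂ) / N * (Real.pi * Complex.I)) := by
  rw [← Complex.exp_nat_mul]
  congr 1
  ring

/-- The numbers `cos (π j / N)`, `1 ≤ j < N / 2`, are linearly independent for `N = p` and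
`N = 2p` with `p` an odd prime. -/
lemma linearIndependent_cos_mul_prime {e p : ℕ} (he : e = 1 ∨ e = 2) (hp : p.Prime)
    (hodd : Odd p) :
    LinearIndependent ℤ (fun j : Fin ((e * p - 1) / 2) =>
      Real.cos (Real.pi * ((j : ℕ) + 1) / (e * p : ℕ))) := by
  obtain ⟨k, rfl⟩ := hodd
  have hk : 0 < k := by
    rcases k.eq_zero_or_pos with rfl | h
    · exact absurd hp (by norm_num)
    · exact h
  have he0 : 0 < e := by omega
  have hM : (e * (2 * k + 1) - 1) / 2 = e * k := by
    rcases he with rfl | rfl <;> omega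
  have hcop : Nat.Coprime (2 * e) (2 * k + 1) := by
    rcases he with rfl | rfl
    · simp
    · have : Nat.Coprime 2 (2 * k + 1) := by simp
      simpa using Nat.Coprime.pow_left 2 this
  have htot : (2 * (e * (2 * k + 1))).totient = 2 * (e * k) := by
    rw [← mul_assoc, Nat.totient_mul hcop, Nat.totient_prime hp]
    rcases he with rfl | rfl
    · simp
    · have : (2 * 2).totient = 2 := by decide
      rw [this, Nat.add_sub_cancel]
  have hN : 0 < e * (2 * k + 1) := by positivity
  have hNC : ((e * (2 * k + 1) : ℕ) : ℂ) ≠ 0 := by exact_mod_cast hN.ne'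
  rw [hM]
  have htop : (altGeomPolynomial e (2 * k + 1)).coeff (2 * (e * k)) = 1 := by
    have := coeff_altGeomPolynomial (p := 2 * k + 1) he0 (2 * k)
    rw [if_pos (by omega), pow_mul] at this
    rw [show 2 * (e * k) = e * (2 * k) by ring, this]
    norm_num
  have hle : (altGeomPolynomial e (2 * k + 1)).natDegree ≤ 2 * (e * k) := by
    have := natDegree_altGeomPolynomial_le e (2 * k + 1)
    rw [Nat.add_sub_cancel] at this
    linarith
  refine linearIndependent_cos_of_monic (R := altGeomPolynomial e (2 * k + 1)) hN htot
    (Polynomial.monic_of_natDegree_le_of_coeff_eq_one _ hle htop)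
    (le_antisymm hle (Polynomial.le_natDegree_of_ne_zero (by rw [htop]; norm_num))) ?_ ?_
  · refine aeval_altGeomPolynomial ⟨k, rfl⟩ ?_ ?_
    · rw [exp_pi_div_pow, div_self hNC, one_mul, Complex.exp_pi_mul_I]
    · -- `ζ ^ e = -1` would give `ζ ^ (2e) = 1`, but `ζ` has order `2e(2k + 1) > 2e`.
      intro h
      have hprim := isPrimitiveRoot_exp_pi_div hN
      have h2 : Complex.exp (Real.pi * Complex.I / (e * (2 * k + 1) : ℕ)) ^ (e * 2) = 1 := by
        rw [pow_mul, h]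
        norm_num
      have := Nat.le_of_dvd (by positivity) (hprim.dvd_of_pow_eq_one _ h2)
      nlinarith
  · rw [coeff_altGeomPolynomial he0, if_pos (by omega)]
    exact pow_ne_zero _ (by norm_num)

/-- The numbers `cos (π j / N)`, `1 ≤ j < N / 2`, are linearly independent for `N` a power
of two. -/
lemma linearIndependent_cos_two_pow (t : ℕ) :
    LinearIndependent ℤ (fun j : Fin ((2 ^ t - 1) / 2) =>
      Real.cos (Real.pi * ((j : ℕ) + 1) / (2 ^ t : ℕ))) := by
  refine linearIndependent_cos_of_two_mul_lt_totient (by positivity) ?_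
  rw [← pow_succ', Nat.totient_prime_pow_succ Nat.prime_two]
  have : 0 < 2 ^ t := by positivity
  omega

/-! ### Transition matrices of blow-ups and the spectrum of the path -/

open scoped Matrix.Norms.Operator in
lemma exp_mulVec_of_mulVec_eq_smul {V : Type*} [Fintype V] [DecidableEq V] {M : Matrix V V ℂ}
    {x : V → ℂ} {μ : ℂ} (h : Matrix.mulVec M x = μ • x) :
    Matrix.mulVec (NormedSpace.exp M) x = Complex.exp μ • x := by
  have hpow : ∀ k : ℕ, Matrix.mulVec (M ^ k) x = μ ^ k • x := by
    intro k
    induction k with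
    | zero => simp
    | succ k ih => rw [pow_succ, ← Matrix.mulVec_mulVec, h, Matrix.mulVec_smul, ih, smul_smul,
        pow_succ, mul_comm]
  have h1 : HasSum (fun k : ℕ => (k.factorial⁻¹ : ℂ) • M ^ k) (NormedSpace.exp M) :=
    NormedSpace.exp_series_hasSum_exp' M
  let L : Matrix V V ℂ →ₗ[ℂ] (V → ℂ) := (Matrix.mulVecBilin ℂ ℂ).flip x
  have h2 := h1.map L.toAddMonoidHom L.continuous_of_finiteDimensional
  have h3 : HasSum (fun k : ℕ => (k.factorial⁻¹ : ℂ) • μ ^ k) (NormedSpace.exp μ) :=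
    NormedSpace.exp_series_hasSum_exp' μ
  rw [← Complex.exp_eq_exp_ℂ] at h3
  refine h2.unique ?_
  convert h3.smul_const x using 2 with k
  simp [L, hpow, smul_smul]

/-- The vector on the blow-up that repeats `x` on every copy of the graph. -/
def blowUpVec {V : Type*} (m : ℕ) (x : V → ℝ) : ZMod m × V → ℂ := fun a => (x a.2 : ℂ)

lemma blowUp_adj {V : Type*} (m : ℕ) (G : SimpleGraph V) (a b : ZMod m × V) :
    (blowUp m G).Adj a b ↔ G.Adj a.2 b.2 := Iff.rfl

section Spectral

variable {V : Type*} [Fintype V] (G : SimpleGraph V)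

open Classical in
lemma adjMatrix_blowUp_mulVec_blowUpVec {x : V → ℝ} {θ : ℝ}
    (h : ∀ k, ∑ l, (if G.Adj k l then x l else 0) = θ * x k) :
    Matrix.mulVec ((blowUp 2 G).adjMatrix ℂ) (blowUpVec 2 x) =
      (2 * θ : ℂ) • blowUpVec 2 x := by
  ext ⟨c, k⟩
  have hk := congrArg (fun r : ℝ => (r : ℂ)) (h k)
  simp only [Matrix.mulVec, dotProduct, SimpleGraph.adjMatrix_apply, Pi.smul_apply, smul_eq_mul,
    blowUpVec, blowUp_adj, Fintype.sum_prod_type, ite_mul, one_mul, zero_mul, Finset.sum_const,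
    Finset.card_univ, ZMod.card]
  push_cast at hk
  simp only [apply_ite, Complex.ofReal_zero] at hk
  rw [hk]
  simp [mul_assoc]

open Classical in
lemma adjMatrix_blowUp_mulVec_single_sub [DecidableEq V] (u : V) :
    Matrix.mulVec ((blowUp 2 G).adjMatrix ℂ) (Pi.single (0, u) 1 - Pi.single (1, u) 1) = 0 := by
  ext a
  simp [blowUp_adj]

/-- If the standard basis vector at `u` is a combination of eigenvectors of `G`, the entry of the
transition matrix of the double blow-up between the two copies of `u` follows: the blow-up has the
eigenvectors of `G` repeated on both copies, with twice the eigenvalue, and the differences of the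
two copies of a vertex, with eigenvalue `0`. -/
lemma transitionMatrix_blowUp_apply [DecidableEq V] {J : Type*} [Fintype J] {x : J → V → ℝ}
    {θ c : J → ℝ}
    (h : ∀ j k, ∑ l, (open Classical in if G.Adj k l then x j l else 0) = θ j * x j k)
    {u : V} (hu : ∀ k, ∑ j, c j * x j k = if k = u then 1 else 0) (t : ℝ) :
    transitionMatrix (blowUp 2 G) t (0, u) (1, u) =
      (∑ j, ((c j * x j u : ℝ) : ℂ) * Complex.exp (Complex.I * ((2 * θ j : ℝ) * t)) - 1) / 2 := by
  classical
  set y : ZMod 2 × V → ℂ := Pi.single (0, u) 1 - Pi.single (1, u) 1 with hy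
  have hy1 : Matrix.mulVec (transitionMatrix (blowUp 2 G) t) y = y := by
    have := exp_mulVec_of_mulVec_eq_smul (M := (Complex.I * (t : ℂ)) • (blowUp 2 G).adjMatrix ℂ)
      (x := y) (μ := 0) (by rw [Matrix.smul_mulVec, hy, adjMatrix_blowUp_mulVec_single_sub]; simp)
    rw [Complex.exp_zero, one_smul] at this
    unfold transitionMatrix
    convert this
  have hx1 : ∀ j, Matrix.mulVec (transitionMatrix (blowUp 2 G) t) (blowUpVec 2 (x j)) =
      Complex.exp (Complex.I * ((2 * θ j : ℝ) * t)) • blowUpVec 2 (x j) := fun j => by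
    unfold transitionMatrix
    convert exp_mulVec_of_mulVec_eq_smul (M := (Complex.I * (t : ℂ)) • (blowUp 2 G).adjMatrix ℂ)
      (x := blowUpVec 2 (x j)) (μ := Complex.I * ((2 * θ j : ℝ) * t)) ?_
    rw [Matrix.smul_mulVec, adjMatrix_blowUp_mulVec_blowUpVec G (h j), smul_smul]
    congr 1
    push_cast
    ring
  have hdec : (Pi.single (1, u) 1 : ZMod 2 × V → ℂ) =
      (1 / 2 : ℂ) • (∑ j, (c j : ℂ) • blowUpVec 2 (x j) - y) := by
    ext ⟨a, k⟩
    have hk := congrArg (fun r : ℝ => (r : ℂ)) (hu k)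
    push_cast at hk
    simp only [Pi.smul_apply, Pi.sub_apply, Finset.sum_apply, smul_eq_mul, blowUpVec, hk, hy,
      Pi.single_apply, Prod.mk.injEq]
    have ha : a = 0 ∨ a = 1 := by revert a; decide
    rcases ha with rfl | rfl <;> by_cases hku : k = u <;> simp [hku]
    norm_num
  have hcol : transitionMatrix (blowUp 2 G) t (0, u) (1, u) =
      Matrix.mulVec (transitionMatrix (blowUp 2 G) t) (Pi.single (1, u) 1) (0, u) := by
    simp
  rw [hcol, hdec, Matrix.mulVec_smul, Matrix.mulVec_sub, hy1, Matrix.mulVec_sum]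
  simp only [Matrix.mulVec_smul, hx1, Pi.smul_apply, Pi.sub_apply, Finset.sum_apply, smul_eq_mul,
    blowUpVec, hy, Pi.single_apply]
  simp only [Complex.ofReal_mul, Complex.ofReal_ofNat, one_div, Prod.mk.injEq, and_true,
    zero_ne_one, if_true, if_false, sub_zero]
  rw [div_eq_inv_mul]
  congr 2
  refine Finset.sum_congr rfl fun j _ => ?_
  ring

end Spectral

/-- The matrix whose row `j` is the eigenvector `k ↦ sin (π (j + 1) (k + 1) / (n + 1))` of the path
on `n` vertices. -/
noncomputable def pathSine (n : ℕ) : Matrix (Fin n) (Fin n) ℝ :=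
  fun j k => Real.sin (((k : ℕ) + 1 : ℕ) * (Real.pi * ((j : ℕ) + 1) / (n + 1 : ℕ)))

/-- The eigenvalue `2 cos (π (j + 1) / (n + 1))` of the path on `n` vertices, that of the
eigenvector `pathSine n j`. -/
noncomputable def pathEigenvalue (n : ℕ) (j : Fin n) : ℝ :=
  2 * Real.cos (Real.pi * ((j : ℕ) + 1) / (n + 1 : ℕ))

open Classical in
lemma sum_pathGraph_adj {n : ℕ} {s : ℕ → ℝ} (h0 : s 0 = 0) (hn : s (n + 1) = 0) (k : Fin n) :
    ∑ l, (if (SimpleGraph.pathGraph n).Adj k l then s ((l : ℕ) + 1) else 0) =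
      s k + s ((k : ℕ) + 2) := by
  have h1 : ∀ l : Fin n, (if (SimpleGraph.pathGraph n).Adj k l then s ((l : ℕ) + 1) else 0) =
      (if (l : ℕ) + 1 = k then s k else 0) +
        (if (l : ℕ) = k + 1 then s ((k : ℕ) + 2) else 0) := by
    intro l
    rw [SimpleGraph.pathGraph_adj]
    split_ifs with h1 h2 h3 h4 h5 h6 h7
    all_goals first | omega | skip
    · rw [h2]; simp
    · rw [h4]; simp
    · simp
  simp_rw [h1]
  rw [Finset.sum_add_distrib]
  congr 1
  · rw [Fin.sum_univ_eq_sum_range (fun l => if l + 1 = (k : ℕ) then s k else 0) n]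
    rcases Nat.eq_zero_or_pos (k : ℕ) with hk | hk
    · simp [hk, h0]
    · rw [Finset.sum_eq_single_of_mem ((k : ℕ) - 1) (by simp; omega)
        fun l _ hl => if_neg (by omega), if_pos (by omega)]
  · rw [Fin.sum_univ_eq_sum_range (fun l => if l = (k : ℕ) + 1 then s ((k : ℕ) + 2) else 0) n,
      Finset.sum_ite_eq']
    split_ifs with h
    · rfl
    · have : (k : ℕ) + 2 = n + 1 := by
        have := k.2
        simp at h
        omega
      rw [this, hn]

open Classical in
lemma pathSine_eigenvector {n : ℕ} (j k : Fin n) :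
    ∑ l, (if (SimpleGraph.pathGraph n).Adj k l then pathSine n j l else 0) =
      pathEigenvalue n j * pathSine n j k := by
  have hN : ((n + 1 : ℕ) : ℝ) ≠ 0 := by positivity
  set φ : ℝ := Real.pi * ((j : ℕ) + 1) / (n + 1 : ℕ) with hφ
  have h := sum_pathGraph_adj (n := n) (s := fun m : ℕ => Real.sin (m * φ)) (by simp) (by
    have : ((n + 1 : ℕ) : ℝ) * φ = ((j : ℕ) + 1 : ℕ) * Real.pi := by
      rw [hφ]
      push_cast at hN ⊢
      field_simp
    rw [this, Real.sin_nat_mul_pi]) k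
  refine h.trans ?_
  rw [pathEigenvalue, pathSine, ← hφ]
  have h1 : (((k : ℕ) : ℕ) : ℝ) * φ = ((k : ℕ) + 1 : ℕ) * φ - φ := by push_cast; ring
  have h2 : (((k : ℕ) + 2 : ℕ) : ℝ) * φ = ((k : ℕ) + 1 : ℕ) * φ + φ := by push_cast; ring
  rw [h1, h2, Real.sin_sub, Real.sin_add]
  ring

lemma pathAngle_mem {n : ℕ} (j : Fin n) :
    0 < Real.pi * ((j : ℕ) + 1) / (n + 1 : ℕ) ∧
      Real.pi * ((j : ℕ) + 1) / (n + 1 : ℕ) < Real.pi := by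
  have hj : ((j : ℕ) : ℝ) + 1 < (n + 1 : ℕ) := by exact_mod_cast Nat.succ_lt_succ j.2
  refine ⟨by positivity, ?_⟩
  rw [div_lt_iff₀ (by positivity)]
  exact mul_lt_mul_of_pos_left hj Real.pi_pos

lemma pathEigenvalue_injective (n : ℕ) : Function.Injective (pathEigenvalue n) := by
  intro i j h
  have h1 := Real.injOn_cos ⟨(pathAngle_mem i).1.le, (pathAngle_mem i).2.le⟩
    ⟨(pathAngle_mem j).1.le, (pathAngle_mem j).2.le⟩ (mul_left_cancel₀ two_ne_zero h)
  have hN : ((n + 1 : ℕ) : ℝ) ≠ 0 := by positivity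
  rw [div_left_inj' hN, mul_right_inj' Real.pi_ne_zero, add_left_inj] at h1
  exact Fin.ext (by exact_mod_cast h1)

/-- Eigenvectors of a symmetric matrix for distinct eigenvalues are orthogonal. -/
lemma pathSine_orthogonal {n : ℕ} {i j : Fin n} (hij : i ≠ j) :
    ∑ k, pathSine n i k * pathSine n j k = 0 := by
  classical
  have h1 : pathEigenvalue n i * ∑ k, pathSine n i k * pathSine n j k =
      pathEigenvalue n j * ∑ k, pathSine n i k * pathSine n j k := by
    calc _ = ∑ k, ∑ l, (if (SimpleGraph.pathGraph n).Adj k l then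
              pathSine n i l * pathSine n j k else 0) := by
          rw [Finset.mul_sum]
          refine Finset.sum_congr rfl fun k _ => ?_
          rw [← mul_assoc, ← pathSine_eigenvector, Finset.sum_mul]
          simp only [ite_mul, zero_mul]
      _ = ∑ l, ∑ k, (if (SimpleGraph.pathGraph n).Adj l k then
              pathSine n i l * pathSine n j k else 0) := by
          rw [Finset.sum_comm]
          simp only [SimpleGraph.adj_comm]
      _ = _ := by
          rw [Finset.mul_sum]
          refine Finset.sum_congr rfl fun k _ => ?_
          rw [mul_left_comm, ← pathSine_eigenvector, Finset.mul_sum]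
          simp only [mul_ite, mul_zero]
  by_contra h
  exact hij (pathEigenvalue_injective n (mul_right_cancel₀ h h1))

lemma pathSine_sq_sum_pos {n : ℕ} (j : Fin n) : 0 < ∑ k, pathSine n j k ^ 2 := by
  have hn : 0 < n := j.pos
  refine Finset.sum_pos' (fun k _ => sq_nonneg _) ⟨⟨0, hn⟩, Finset.mem_univ _, ?_⟩
  have : 0 < pathSine n j ⟨0, hn⟩ := by
    have := Real.sin_pos_of_pos_of_lt_pi (pathAngle_mem j).1 (pathAngle_mem j).2
    simpa [pathSine] using this
  positivity

/-- The orthogonal eigenvectors `pathSine n j` form a complete system. -/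
lemma sum_pathSine_mul_pathSine_div {n : ℕ} (u k : Fin n) :
    ∑ j, pathSine n j u / (∑ l, pathSine n j l ^ 2) * pathSine n j k =
      if k = u then 1 else 0 := by
  set D : Matrix (Fin n) (Fin n) ℝ := fun k j => pathSine n j k / ∑ l, pathSine n j l ^ 2 with hD
  have h1 : pathSine n * D = 1 := by
    ext i j
    rw [Matrix.mul_apply]
    simp only [hD, mul_div_assoc']
    rw [← Finset.sum_div, Matrix.one_apply]
    split_ifs with hij
    · subst hij
      rw [div_eq_one_iff_eq (pathSine_sq_sum_pos i).ne']
      simp only [sq]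
    · rw [pathSine_orthogonal hij, zero_div]
  have h2 := congrArg (fun M : Matrix (Fin n) (Fin n) ℝ => M k u) (mul_eq_one_comm.1 h1)
  simp only [Matrix.mul_apply, Matrix.one_apply] at h2
  rw [← h2]
  refine Finset.sum_congr rfl fun j _ => ?_
  simp only [hD]
  ring

/-- The squared `u`-th entry of the `j`-th normalized eigenvector of the path. -/
noncomputable def pathWeight (n : ℕ) (u j : Fin n) : ℝ :=
  pathSine n j u ^ 2 / ∑ l, pathSine n j l ^ 2

lemma pathWeight_nonneg {n : ℕ} (u j : Fin n) : 0 ≤ pathWeight n u j := by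
  unfold pathWeight
  positivity

lemma sum_pathWeight {n : ℕ} (u : Fin n) : ∑ j, pathWeight n u j = 1 := by
  have := sum_pathSine_mul_pathSine_div u u
  rw [if_pos rfl] at this
  rw [← this]
  refine Finset.sum_congr rfl fun j _ => ?_
  rw [pathWeight]
  ring

lemma transitionMatrix_blowUp_pathGraph_apply {n : ℕ} (u : Fin n) (t : ℝ) :
    transitionMatrix (blowUp 2 (SimpleGraph.pathGraph n)) t (0, u) (1, u) =
      (∑ j, (pathWeight n u j : ℂ) *
        Complex.exp (Complex.I * ((2 * pathEigenvalue n j : ℝ) * t)) - 1) / 2 := by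
  rw [transitionMatrix_blowUp_apply _ pathSine_eigenvector (sum_pathSine_mul_pathSine_div u)]
  have : ∀ j, pathSine n j u / (∑ l, pathSine n j l ^ 2) * pathSine n j u = pathWeight n u j :=
    fun j => by rw [pathWeight]; ring
  simp only [this]

/-- If `j` is half of `n + 1`, the weight `sin² (π (u + 1) / 2)` detects the parity of `u`. -/
lemma pathWeight_eq_zero_iff {n : ℕ} (u j : Fin n) (hj : 2 * ((j : ℕ) + 1) = n + 1) :
    pathWeight n u j = 0 ↔ Even ((u : ℕ) + 1) := by
  rw [pathWeight, div_eq_zero_iff, or_iff_left (pathSine_sq_sum_pos j).ne',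
    pow_eq_zero_iff two_ne_zero, pathSine, Real.sin_eq_zero_iff]
  have h1 : ((n + 1 : ℕ) : ℝ) = 2 * (((j : ℕ) : ℝ) + 1) := by rw [← hj]; push_cast; ring
  have h2 : Real.pi * (((j : ℕ) : ℝ) + 1) / (n + 1 : ℕ) = Real.pi / 2 := by
    rw [h1]; field_simp
  rw [h2]
  constructor
  · rintro ⟨m, hm⟩
    have h3 : ((2 * m : ℤ) : ℝ) = (((u : ℕ) + 1 : ℕ) : ℤ) := by
      have := Real.pi_pos
      push_cast at hm ⊢
      apply mul_right_cancel₀ this.ne'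
      linarith
    have h4 : 2 * m = (((u : ℕ) + 1 : ℕ) : ℤ) := by exact_mod_cast h3
    exact even_iff_two_dvd.2 (by omega)
  · rintro ⟨m, hm⟩
    refine ⟨m, ?_⟩
    rw [hm]
    push_cast
    ring

/-! ### State transfer in the blow-up of the path -/

/-- A half of the spectrum of the path controls all of it, since the spectrum is symmetric about
`0`: if the positive eigenvalues are linearly independent and the eigenvalue `0`, if present, does
not contribute at `u`, then Kronecker's theorem brings all relevant phases close to `-1` at once. -/
lemma hasPGST_of_linearIndependent_cos {n : ℕ} (u : Fin n)
    (hind : LinearIndependent ℤ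
      (fun j : Fin (n / 2) => Real.cos (Real.pi * ((j : ℕ) + 1) / (n + 1 : ℕ))))
    (hmid : ∀ j : Fin n, 2 * ((j : ℕ) + 1) = n + 1 → pathWeight n u j = 0) :
    HasPGST (blowUp 2 (SimpleGraph.pathGraph n)) (0, u) (1, u) := by
  have hind' : LinearIndependent ℤ (fun j : Fin (n / 2) =>
      2 * (2 * Real.cos (Real.pi * ((j : ℕ) + 1) / (n + 1 : ℕ)))) := by
    rw [Fintype.linearIndependent_iff] at hind ⊢
    intro g hg
    refine hind g ?_
    simp only [zsmul_eq_mul] at hg ⊢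
    have h4 : (4 : ℝ) * ∑ j : Fin (n / 2),
        (g j : ℝ) * Real.cos (Real.pi * ((j : ℕ) + 1) / (n + 1 : ℕ)) = 0 := by
      rw [← hg, Finset.mul_sum]
      refine Finset.sum_congr rfl fun j _ => ?_
      ring
    exact (mul_eq_zero.1 h4).resolve_left (by norm_num)
  have hε : ∀ k : ℕ, (0 : ℝ) < 1 / ((k : ℝ) + 1) := fun k => by positivity
  choose τ hτ using fun k : ℕ => exists_forall_norm_exp_sub_lt hind' (w := fun _ => -1)
    (fun _ => by simp) (hε k)
  refine ⟨τ, ?_⟩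
  -- The phase attached to an eigenvalue `2 cos (π (j + 1) / (n + 1))`; for `j` beyond the middle it
  -- is the conjugate of the phase attached to the mirror image of `j`.
  have hphase : ∀ (k : ℕ) (j : Fin n), 2 * ((j : ℕ) + 1) ≠ n + 1 →
      ‖Complex.exp (Complex.I * ((2 * pathEigenvalue n j : ℝ) * τ k)) + 1‖ ≤
        1 / ((k : ℝ) + 1) := by
    intro k j hj
    rcases lt_or_gt_of_ne hj with hlt | hgt
    · have h := (hτ k ⟨j, by omega⟩).le
      rw [sub_neg_eq_add] at h
      exact h
    · have hjn := j.2
      have h := (hτ k ⟨n - 1 - j, by omega⟩).le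
      rw [sub_neg_eq_add] at h
      refine le_of_eq_of_le ?_ h
      rw [← RCLike.norm_conj, map_add, map_one, ← Complex.exp_conj]
      congr 3
      have hcos : Real.cos (Real.pi * (((n - 1 - (j : ℕ) : ℕ) : ℝ) + 1) / (n + 1 : ℕ)) =
          -Real.cos (Real.pi * ((j : ℕ) + 1) / (n + 1 : ℕ)) := by
        rw [← Real.cos_pi_sub]
        congr 1
        have h1 : ((n - 1 - (j : ℕ) : ℕ) : ℝ) = n - 1 - (j : ℕ) := by
          rw [Nat.cast_sub (by omega), Nat.cast_sub (by omega)]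
          simp
        rw [h1]
        push_cast
        field_simp
        ring
      simp only [hcos, pathEigenvalue, map_mul, Complex.conj_I, Complex.conj_ofReal]
      push_cast
      ring
  have hbound : ∀ k : ℕ,
      ‖transitionMatrix (blowUp 2 (SimpleGraph.pathGraph n)) (τ k) (0, u) (1, u) - (-1)‖ ≤
        1 / ((k : ℝ) + 1) := by
    intro k
    have hsum : ∑ j, (pathWeight n u j : ℂ) = 1 := by
      rw [← Complex.ofReal_sum, sum_pathWeight, Complex.ofReal_one]
    have heq : transitionMatrix (blowUp 2 (SimpleGraph.pathGraph n)) (τ k) (0, u) (1, u) - (-1) =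
        (∑ j, (pathWeight n u j : ℂ) *
          (Complex.exp (Complex.I * ((2 * pathEigenvalue n j : ℝ) * τ k)) + 1)) / 2 := by
      rw [transitionMatrix_blowUp_pathGraph_apply]
      simp_rw [mul_add, mul_one]
      rw [Finset.sum_add_distrib, hsum]
      ring
    have hle : ‖∑ j, (pathWeight n u j : ℂ) *
          (Complex.exp (Complex.I * ((2 * pathEigenvalue n j : ℝ) * τ k)) + 1)‖ ≤
        1 / ((k : ℝ) + 1) := by
      calc _ ≤ ∑ j, pathWeight n u j * (1 / ((k : ℝ) + 1)) := by
            refine norm_sum_le_of_le _ fun j _ => ?_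
            rw [norm_mul, Complex.norm_real, Real.norm_of_nonneg (pathWeight_nonneg u j)]
            by_cases hj : 2 * ((j : ℕ) + 1) = n + 1
            · simp [hmid j hj]
            · exact mul_le_mul_of_nonneg_left (hphase k j hj) (pathWeight_nonneg u j)
        _ = _ := by rw [← Finset.sum_mul, sum_pathWeight, one_mul]
    rw [heq, norm_div, Complex.norm_ofNat]
    have := hε k
    linarith
  have hlim : Tendsto (fun k =>
      transitionMatrix (blowUp 2 (SimpleGraph.pathGraph n)) (τ k) (0, u) (1, u)) atTop
      (𝓝 (-1)) :=
    tendsto_iff_norm_sub_tendsto_zero.2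
      (squeeze_zero (fun _ => norm_nonneg _) hbound tendsto_one_div_add_atTop_nhds_zero_nat)
  simpa using hlim.norm

/-- If the eigenvalue `0` of the path has positive weight at `u`, its constant phase `1` cancels
part of the `-1` from the vector antisymmetric in the two copies of `u`, which keeps the transition
amplitude away from the unit circle. -/
lemma not_hasPGST_of_pathWeight_pos {n : ℕ} (u j : Fin n) (hj : 2 * ((j : ℕ) + 1) = n + 1)
    (hpos : 0 < pathWeight n u j) :
    ¬ HasPGST (blowUp 2 (SimpleGraph.pathGraph n)) (0, u) (1, u) := by
  rintro ⟨τ, hτ⟩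
  have heig : pathEigenvalue n j = 0 := by
    have h1 : ((n + 1 : ℕ) : ℝ) = 2 * (((j : ℕ) : ℝ) + 1) := by rw [← hj]; push_cast; ring
    have h2 : Real.pi * (((j : ℕ) : ℝ) + 1) / (n + 1 : ℕ) = Real.pi / 2 := by
      rw [h1]; field_simp
    rw [pathEigenvalue, h2, Real.cos_pi_div_two, mul_zero]
  have hsum : pathWeight n u j + ∑ i ∈ Finset.univ.erase j, pathWeight n u i = 1 := by
    rw [Finset.add_sum_erase _ _ (Finset.mem_univ j), sum_pathWeight]
  have hbound : ∀ k,
      ‖transitionMatrix (blowUp 2 (SimpleGraph.pathGraph n)) (τ k) (0, u) (1, u)‖ ≤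
        1 - pathWeight n u j := by
    intro k
    have h1 : ‖∑ i ∈ Finset.univ.erase j, (pathWeight n u i : ℂ) *
        Complex.exp (Complex.I * ((2 * pathEigenvalue n i : ℝ) * τ k))‖ ≤
        ∑ i ∈ Finset.univ.erase j, pathWeight n u i := by
      refine norm_sum_le_of_le _ fun i _ => ?_
      have h2 : Complex.I * (((2 * pathEigenvalue n i : ℝ) : ℂ) * τ k) =
          ((2 * pathEigenvalue n i * τ k : ℝ) : ℂ) * Complex.I := by
        push_cast
        ring
      rw [norm_mul, Complex.norm_real, Real.norm_of_nonneg (pathWeight_nonneg u i), h2,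
        Complex.norm_exp_ofReal_mul_I, mul_one]
    have h3 : ‖(pathWeight n u j : ℂ) - 1‖ = 1 - pathWeight n u j := by
      rw [← Complex.ofReal_one, ← Complex.ofReal_sub, Complex.norm_real, Real.norm_eq_abs,
        abs_sub_comm, abs_of_nonneg]
      have := Finset.sum_nonneg fun i (_ : i ∈ Finset.univ.erase j) => pathWeight_nonneg u i
      linarith
    rw [transitionMatrix_blowUp_pathGraph_apply, ← Finset.add_sum_erase _ _ (Finset.mem_univ j),
      heig, norm_div, Complex.norm_ofNat, add_sub_right_comm]
    simp only [mul_zero, Complex.ofReal_zero, zero_mul, Complex.exp_zero, mul_one]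
    have := norm_add_le ((pathWeight n u j : ℂ) - 1) (∑ i ∈ Finset.univ.erase j,
      (pathWeight n u i : ℂ) * Complex.exp (Complex.I * ((2 * pathEigenvalue n i : ℝ) * τ k)))
    linarith
  have := le_of_tendsto' hτ hbound
  linarith

/-- The path on `n` vertices is `SimpleGraph.pathGraph n`, whose vertices are the elements
`0, …, n - 1` of `Fin n`; the vertex with the usual label `j ∈ {1, …, n}` is the element `j - 1`,
so the label of `u : Fin n` is `u + 1`. -/
theorem mainTheorem7 (n : ℕ)
    (hn : (∃ p : ℕ, p.Prime ∧ Odd p ∧ n = p - 1) ∨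
      (∃ p : ℕ, p.Prime ∧ n = 2 * p - 1) ∨
      (∃ t : ℕ, 1 ≤ t ∧ n = 2 ^ t - 1))
    (u : Fin n) :
    HasPGST (blowUp 2 (SimpleGraph.pathGraph n)) (0, u) (1, u) ↔
      (∃ p : ℕ, p.Prime ∧ Odd p ∧ n = p - 1) ∨
      (((∃ p : ℕ, p.Prime ∧ n = 2 * p - 1) ∨ (∃ t : ℕ, 1 ≤ t ∧ n = 2 ^ t - 1)) ∧
        Even ((u : ℕ) + 1)) := by
  rcases hn with h | h
  · refine iff_of_true ?_ (Or.inl h)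
    obtain ⟨p, hp, hodd, rfl⟩ := h
    have hp1 : p - 1 + 1 = 1 * p := by have := hp.one_lt; omega
    have hind := linearIndependent_cos_mul_prime (e := 1) (Or.inl rfl) hp hodd
    rw [← hp1] at hind
    refine hasPGST_of_linearIndependent_cos u hind fun j hj => ?_
    obtain ⟨k, rfl⟩ := hodd
    omega
  · have hN : Even (n + 1) := by
      rcases h with ⟨p, hp, rfl⟩ | ⟨t, ht, rfl⟩
      · have := hp.one_lt
        exact even_iff_two_dvd.2 ⟨p, by omega⟩
      · rw [Nat.sub_add_cancel Nat.one_le_two_pow]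
        exact (Nat.even_pow.2 ⟨even_two, by omega⟩)
    have hind : LinearIndependent ℤ
        (fun j : Fin (n / 2) => Real.cos (Real.pi * ((j : ℕ) + 1) / (n + 1 : ℕ))) := by
      have htwo : ∀ t : ℕ, n + 1 = 2 ^ t → LinearIndependent ℤ
          (fun j : Fin (n / 2) => Real.cos (Real.pi * ((j : ℕ) + 1) / (n + 1 : ℕ))) := by
        intro t ht
        have hind := linearIndependent_cos_two_pow t
        rw [← ht] at hind
        exact hind
      rcases h with ⟨p, hp, hnp⟩ | ⟨t, ht, hnt⟩
      · rcases hp.eq_two_or_odd' with rfl | hodd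
        · exact htwo 2 (by omega)
        · have hind := linearIndependent_cos_mul_prime (e := 2) (Or.inr rfl) hp hodd
          have hp1 : n + 1 = 2 * p := by have := hp.one_lt; omega
          rw [← hp1] at hind
          exact hind
      · exact htwo t (by rw [hnt, Nat.sub_add_cancel Nat.one_le_two_pow])
    constructor
    · intro hpgst
      refine Or.inr ⟨h, ?_⟩
      by_contra hu
      obtain ⟨m, hm⟩ := hN
      have hj : 2 * ((m - 1 : ℕ) + 1) = n + 1 := by omega
      have hmn : m - 1 < n := by omega
      have hw : pathWeight n u ⟨m - 1, hmn⟩ ≠ 0 := fun h0 =>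
        hu ((pathWeight_eq_zero_iff u ⟨m - 1, hmn⟩ hj).1 h0)
      exact not_hasPGST_of_pathWeight_pos u ⟨m - 1, hmn⟩ hj
        ((pathWeight_nonneg u _).lt_of_ne' hw) hpgst
    · rintro (⟨p, hp, hodd, rfl⟩ | ⟨-, hu⟩)
      · -- `n + 1` cannot be both even and equal to an odd prime.
        rw [Nat.sub_add_cancel hp.one_le] at hN
        exact absurd hN (Nat.not_even_iff_odd.2 hodd)
      · exact hasPGST_of_linearIndependent_cos u hind fun j hj =>
          (pathWeight_eq_zero_iff u j hj).2 hu
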